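/- A $\mathbb Z_2$-graded unital $C^*$-algebra is a pair $(\mathfrak A,\alpha)$ consisting of a unital $C^*$-algebra $\mathfrak A$ and a $*$-automorphism $\alpha$ of $\mathfrak A$ with $\alpha^2=\mathrm{id}$; its homogeneous components are $\mathfrak A_{\pm1}=\tfrac12(\mathrm{id}\pm\alpha)(\mathfrak A)$, and a nonzero $a\in\mathfrak A_{\pm1}$ has grade $\partial(a)=\pm1$. For homogeneous $a,b$ (possibly in different algebras) put $\epsilon(a,b)=-1$ if $\partial(a)=\partial(b)=-1$, and $\epsilon(a,b)=1$ otherwise. The algebraic Fermi tensor product $\mathfrak A_1\,Ⓕ\,\mathfrak A_2$ of $(\mathfrak A_1,\alpha_1)$ and $(\mathfrak A_2,\alpha_2)$ is the algebraic tensor product of the vector spaces $\mathfrak A_1,\mathfrak A_2$, with elementary tensors written $a_1\,Ⓕ\,a_2$, equipped with the product and involution determined, for homogeneous elements, by $$(a_1Ⓕa_2)(b_1Ⓕb_2)=\epsilon(a_2,b_1)\,a_1b_1\,Ⓕ\,a_2b_2,\qquad (a_1Ⓕa_2)^*=\epsilon(a_1,a_2)\,a_1^*\,Ⓕ\,a_2^*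 .$$ Its completion with respect to the maximal $C^*$-norm $c\mapsto\sup\{\|\pi(c)\| : \pi \text{ a } *\text{-representation of } \mathfrak A_1Ⓕ\mathfrak A_2 \text{ by bounded operators on a Hilbert space}\}$ is the $C^*$-algebra denoted by $\mathfrak A_1Ⓕ_{\max}\mathfrak A_2$. It is $\mathbb Z_2$-graded by the involutive $*$-automorphism $\alpha_1Ⓕ\alpha_2$ that extends $a_1Ⓕa_2\mapsto\alpha_1(a_1)Ⓕ\alpha_2(a_2)$ continuously. Theorem. Let $(\mathfrak A_i,\alpha_i)$, $i=1,2$, be $\mathbb Z_2$-graded unital $C^*$-algebras, $\mathfrak B$ a unital $C^*$-algebra, and $\pi_i:\mathfrak A_i\to\mathfrak B$, $i=1,2$, unital $*$-homomorphisms such that $$\pi_1(a_1)\pi_2(a_2)=\epsilon(a_1,a_2)\,\pi_2(a_2)\pi_1(a_1)$$ for all homogeneous $a_1\in\mathfrak A_1$, $a_2\in\mathfrak A_2$. Then there exists a unique $*$-homomorphism $\pi:\mathfrak A_1Ⓕ_{\max}\mathfrak A_2\to\mathfrak B$ such that $$\pi(a_1Ⓕa_2)=\pi_1(a_1)\pi_2(a_2)\quad\text{for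 all } a_1\in\mathfrak A_1,\ a_2\in\mathfrak A_2,$$ and $\pi$ is unital. Moreover, $\pi(\mathfrak A_1Ⓕ_{\max}\mathfrak A_2)$ is the $C^*$-subalgebra of $\mathfrak B$ generated by $\pi_1(\mathfrak A_1)$ and $\pi_2(\mathfrak A_2)$. If in addition $\beta$ is a $*$-automorphism of $\mathfrak B$ with $\beta^2=\mathrm{id}$ and $\pi_i\circ\alpha_i=\beta\circ\pi_i$ for $i=1,2$, then $\pi\circ(\alpha_1Ⓕ\alpha_2)=\beta\circ\pi$. -/

import Mathlib

open scoped TensorProduct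

noncomputable section

/-- A `ℤ₂`-grading of a `*`-algebra over `ℂ`: an involutive `*`-automorphism. -/
structure Z2Grading (A : Type*) [Ring A] [Algebra ℂ A] [Star A] where
  /-- The grading automorphism. -/
  aut : A ≃⋆ₐ[ℂ] A
  involutive : ∀ a, aut (aut a) = a

/-- The sign `ε(i, j)`, with `ℤ₂` written additively: `0` is the even grade, `1` the odd grade. -/
def fermiSign (i j : ZMod 2) : ℂ := if i = 1 ∧ j = 1 then -1 else 1

namespace Z2Grading

variable {A : Type*} [Ring A] [Algebra ℂ A] [StarRing A] (α : Z2Grading A)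

/-- The projection `(id + α) / 2` onto the even part (`i = 0`), and the projection
`(id - α) / 2` onto the odd part (`i = 1`). -/
def proj (i : ZMod 2) : A →ₗ[ℂ] A :=
  (2⁻¹ : ℂ) • (LinearMap.id + (if i = 1 then (-1 : ℂ) else 1) • (α.aut : A →ₗ[ℂ] A))

/-- The homogeneous components: the even part for `i = 0` and the odd part for `i = 1`. -/
def part (i : ZMod 2) : Submodule ℂ A := LinearMap.range (α.proj i)

theorem proj_zero_apply (a : A) : α.proj 0 a = (2⁻¹ : ℂ) • (a + α.aut a) := by
  simp [proj]

theorem proj_one_apply (a : A) : α.proj 1 a = (2⁻¹ : ℂ) • (a - α.aut a) := by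
  simp [proj, sub_eq_add_neg]

theorem mem_part_zero {a : A} : a ∈ α.part 0 ↔ α.aut a = a := by
  constructor
  · rintro ⟨b, rfl⟩
    rw [proj_zero_apply, map_smul, map_add, α.involutive, add_comm]
  · intro h
    refine ⟨a, ?_⟩
    rw [proj_zero_apply, h, ← two_smul ℂ, smul_smul]
    norm_num

theorem mem_part_one {a : A} : a ∈ α.part 1 ↔ α.aut a = -a := by
  constructor
  · rintro ⟨b, rfl⟩
    rw [proj_one_apply, map_smul, map_sub, α.involutive, ← smul_neg, neg_sub]
  · intro h
    refine ⟨a, ?_⟩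
    rw [proj_one_apply, h, sub_neg_eq_add, ← two_smul ℂ, smul_smul]
    norm_num

theorem proj_mem (i : ZMod 2) (a : A) : α.proj i a ∈ α.part i := ⟨a, rfl⟩

theorem proj_add_proj (a : A) : α.proj 0 a + α.proj 1 a = a := by
  rw [proj_zero_apply, proj_one_apply, ← smul_add, add_add_sub_cancel, ← two_smul ℂ, smul_smul]
  norm_num

theorem zmod_two_cases (i : ZMod 2) : i = 0 ∨ i = 1 := by
  revert i; decide

theorem proj_of_mem (i j : ZMod 2) {a : A} (h : a ∈ α.part j) :
    α.proj i a = if i = j then a else 0 := by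
  rcases zmod_two_cases i with rfl | rfl <;> rcases zmod_two_cases j with rfl | rfl
  · rw [mem_part_zero] at h
    rw [proj_zero_apply, h, ← two_smul ℂ, smul_smul]
    norm_num
  · rw [mem_part_one] at h
    rw [proj_zero_apply, h]
    simp
  · rw [mem_part_zero] at h
    rw [proj_one_apply, h]
    simp
  · rw [mem_part_one] at h
    rw [proj_one_apply, h, sub_neg_eq_add, ← two_smul ℂ, smul_smul]
    norm_num

theorem aut_of_mem {i : ZMod 2} {a : A} (h : a ∈ α.part i) :
    α.aut a = (if i = 1 then (-1 : ℂ) else 1) • a := by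
  rcases zmod_two_cases i with rfl | rfl
  · simpa using α.mem_part_zero.1 h
  · simpa using α.mem_part_one.1 h

theorem star_mem {i : ZMod 2} {a : A} (h : a ∈ α.part i) : star a ∈ α.part i := by
  rcases zmod_two_cases i with rfl | rfl
  · rw [mem_part_zero] at h ⊢
    rw [map_star, h]
  · rw [mem_part_one] at h ⊢
    rw [map_star, h, star_neg]

theorem aut_mem {i : ZMod 2} {a : A} (h : a ∈ α.part i) : α.aut a ∈ α.part i := by
  rw [α.aut_of_mem h]
  exact (α.part i).smul_mem _ h

theorem mul_mem_part {i j : ZMod 2} {a b : A} (ha : a ∈ α.part i) (hb : b ∈ α.part j) :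
    a * b ∈ α.part (i + j) := by
  rcases zmod_two_cases i with rfl | rfl <;> rcases zmod_two_cases j with rfl | rfl
  · rw [add_zero]
    rw [mem_part_zero] at *
    rw [map_mul, ha, hb]
  · rw [zero_add]
    rw [mem_part_one] at *
    rw [mem_part_zero] at ha
    rw [map_mul, ha, hb, mul_neg]
  · rw [add_zero]
    rw [mem_part_one] at *
    rw [mem_part_zero] at hb
    rw [map_mul, ha, hb, neg_mul]
  · rw [show (1 + 1 : ZMod 2) = 0 from rfl, mem_part_zero]
    rw [mem_part_one] at *
    rw [map_mul, ha, hb, neg_mul_neg]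

instance : SetLike.GradedMonoid α.part where
  one_mem := by rw [mem_part_zero, map_one]
  mul_mem _ _ _ _ ha hb := α.mul_mem_part ha hb

/-- The projection onto a homogeneous component, as a map into that component. -/
def projPart (i : ZMod 2) : A →ₗ[ℂ] α.part i :=
  (α.proj i).codRestrict (α.part i) (α.proj_mem i)

theorem projPart_of_mem (i j : ZMod 2) (x : α.part j) :
    (α.projPart i x : A) = if i = j then (x : A) else 0 :=
  α.proj_of_mem i j x.2

instance : DirectSum.Decomposition α.part :=
  DirectSum.Decomposition.ofLinearMap α.part
    (DirectSum.lof ℂ (ZMod 2) (fun i => α.part i) 0 ∘ₗ α.projPart 0 +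
      DirectSum.lof ℂ (ZMod 2) (fun i => α.part i) 1 ∘ₗ α.projPart 1)
    (by
      ext a
      simp only [LinearMap.comp_apply, LinearMap.add_apply, map_add, DirectSum.coeLinearMap_lof]
      exact α.proj_add_proj a)
    (by
      refine DirectSum.linearMap_ext ℂ fun i => LinearMap.ext fun x => ?_
      simp only [LinearMap.comp_apply, LinearMap.add_apply, DirectSum.coeLinearMap_lof,
        LinearMap.id_apply]
      rcases zmod_two_cases i with rfl | rfl
      · have h0 : α.projPart 0 (x : A) = x := Subtype.ext (by simp [projPart_of_mem])
        have h1 : α.projPart 1 (x : A) = 0 := Subtype.ext (by simp [projPart_of_mem])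
        rw [h0, h1, map_zero, add_zero]
      · have h0 : α.projPart 0 (x : A) = 0 := Subtype.ext (by simp [projPart_of_mem])
        have h1 : α.projPart 1 (x : A) = x := Subtype.ext (by simp [projPart_of_mem])
        rw [h0, h1, map_zero, zero_add])

instance : GradedAlgebra α.part where

end Z2Grading

/-- The algebraic Fermi tensor product of two `ℤ₂`-graded `C*`-algebras: the tensor product
`A ⊗ B` of vector spaces with the product determined by
`(a ⊗ b) (a' ⊗ b') = ε(∂ b, ∂ a') a a' ⊗ b b'` for homogeneous `b` and `a'`. -/
def FermiTensor {A B : Type*} [CStarAlgebra A] [CStarAlgebra B]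
    (α : Z2Grading A) (β : Z2Grading B) : Type _ := α.part ᵍ⊗[ℂ] β.part

namespace FermiTensor

universe u v

variable {A : Type u} {B : Type v} [CStarAlgebra A] [CStarAlgebra B]
variable (α : Z2Grading A) (β : Z2Grading B)

instance : Ring (FermiTensor α β) := inferInstanceAs (Ring (α.part ᵍ⊗[ℂ] β.part))

instance : Algebra ℂ (FermiTensor α β) := inferInstanceAs (Algebra ℂ (α.part ᵍ⊗[ℂ] β.part))

/-- The identification with the tensor product of vector spaces. -/
def of : A ⊗[ℂ] B ≃ₗ[ℂ] FermiTensor α β := GradedTensorProduct.of ℂ α.part β.part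

/-- Elementary tensors. -/
def tmul (a : A) (b : B) : FermiTensor α β := of α β (a ⊗ₜ[ℂ] b)

/-- The linear map multiplying the component of bidegree `(i, j)` by `ε(i, j)`. -/
def signMap : A ⊗[ℂ] B →ₗ[ℂ] A ⊗[ℂ] B :=
  ∑ i : ZMod 2, ∑ j : ZMod 2, fermiSign i j • TensorProduct.map (α.proj i) (β.proj j)

/-- The involution `x* = ∑ ε(i, j) x_{ij}^†`, where `(a ⊗ b)^† = a* ⊗ b*`. -/
instance : Star (FermiTensor α β) where
  star x := of α β (star (signMap α β ((of α β).symm x)))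

variable {α β}

theorem star_fermiSign (i j : ZMod 2) : star (fermiSign i j) = fermiSign i j := by
  unfold fermiSign; split_ifs <;> simp

theorem tmul_add (a : A) (b b' : B) : tmul α β a (b + b') = tmul α β a b + tmul α β a b' := by
  simp [tmul, TensorProduct.tmul_add]

theorem add_tmul (a a' : A) (b : B) : tmul α β (a + a') b = tmul α β a b + tmul α β a' b := by
  simp [tmul, TensorProduct.add_tmul]

theorem smul_tmul (c : ℂ) (a : A) (b : B) : tmul α β (c • a) b = c • tmul α β a b := by
  simp [tmul, ← TensorProduct.smul_tmul']

theorem tmul_smul (c : ℂ) (a : A) (b : B) : tmul α β a (c • b) = c • tmul α β a b := by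
  simp [tmul]

theorem one_def : (1 : FermiTensor α β) = tmul α β 1 1 := rfl

theorem tmul_mul_tmul {i j : ZMod 2} (a : A) {b : B} (hb : b ∈ β.part j) {a' : A}
    (ha' : a' ∈ α.part i) (b' : B) :
    tmul α β a b * tmul α β a' b' = fermiSign j i • tmul α β (a * a') (b * b') := by
  have h := GradedTensorProduct.tmul_coe_mul_coe_tmul (R := ℂ) α.part β.part a
    (⟨b, hb⟩ : β.part j) (⟨a', ha'⟩ : α.part i) b'
  refine h.trans ?_
  rcases Z2Grading.zmod_two_cases i with rfl | rfl <;>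
    rcases Z2Grading.zmod_two_cases j with rfl | rfl <;>
    simp [fermiSign, tmul, of] <;> rfl

theorem star_tmul {i j : ZMod 2} {a : A} (ha : a ∈ α.part i) {b : B} (hb : b ∈ β.part j) :
    star (tmul α β a b) = fermiSign i j • tmul α β (star a) (star b) := by
  change of α β (star (signMap α β ((of α β).symm (of α β (a ⊗ₜ[ℂ] b))))) = _
  have : signMap α β (a ⊗ₜ[ℂ] b) = fermiSign i j • (a ⊗ₜ[ℂ] b) := by
    simp only [signMap, LinearMap.sum_apply, LinearMap.smul_apply, TensorProduct.map_tmul,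
      α.proj_of_mem _ _ ha, β.proj_of_mem _ _ hb]
    rw [Finset.sum_eq_single i, Finset.sum_eq_single j] <;> simp +contextual
  rw [LinearEquiv.symm_apply_apply, this, star_smul, star_fermiSign, map_smul]
  rfl

/-- To prove an additive statement, it suffices to treat tensors of homogeneous elements. -/
theorem induction_on {P : FermiTensor α β → Prop} (x : FermiTensor α β)
    (tmul : ∀ (i j : ZMod 2) (a : A) (b : B), a ∈ α.part i → b ∈ β.part j → P (tmul α β a b))
    (add : ∀ x y, P x → P y → P (x + y)) : P x := by
  obtain ⟨t, rfl⟩ := (of α β).surjective x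
  induction t using TensorProduct.induction_on with
  | zero =>
    have := tmul 0 0 0 0 (Submodule.zero_mem _) (Submodule.zero_mem _)
    simpa [FermiTensor.tmul] using this
  | add x y hx hy => rw [map_add]; exact add _ _ hx hy
  | tmul a b =>
    change P (FermiTensor.tmul α β a b)
    rw [← α.proj_add_proj a, ← β.proj_add_proj b, add_tmul, tmul_add, tmul_add]
    exact add _ _
      (add _ _ (tmul _ _ _ _ (α.proj_mem _ _) (β.proj_mem _ _))
        (tmul _ _ _ _ (α.proj_mem _ _) (β.proj_mem _ _)))
      (add _ _ (tmul _ _ _ _ (α.proj_mem _ _) (β.proj_mem _ _))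
        (tmul _ _ _ _ (α.proj_mem _ _) (β.proj_mem _ _)))

theorem star_add' (x y : FermiTensor α β) : star (x + y) = star x + star y := by
  change of α β (star (signMap α β ((of α β).symm (x + y)))) = _
  rw [map_add, map_add, star_add, map_add]
  rfl

theorem star_smul' (c : ℂ) (x : FermiTensor α β) : star (c • x) = star c • star x := by
  change of α β (star (signMap α β ((of α β).symm (c • x)))) = _
  rw [map_smul, map_smul, star_smul, map_smul]
  rfl

theorem fermiSign_mul_self (i j : ZMod 2) : fermiSign i j * fermiSign i j = 1 := by
  unfold fermiSign; split_ifs <;> simp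

theorem fermiSign_star_mul (i j k l : ZMod 2) :
    fermiSign j k * fermiSign (i + k) (j + l) =
      fermiSign k l * (fermiSign i j * fermiSign l i) := by
  have h : (1 + 1 : ZMod 2) = 0 := rfl
  rcases Z2Grading.zmod_two_cases i with rfl | rfl <;>
    rcases Z2Grading.zmod_two_cases j with rfl | rfl <;>
    rcases Z2Grading.zmod_two_cases k with rfl | rfl <;>
    rcases Z2Grading.zmod_two_cases l with rfl | rfl <;>
    simp [fermiSign, h]

instance : StarRing (FermiTensor α β) where
  star_involutive x := by
    induction x using induction_on with
    | add x y hx hy => rw [star_add', star_add', hx, hy]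
    | tmul i j a b ha hb =>
      rw [star_tmul ha hb, star_smul', star_tmul (α.star_mem ha) (β.star_mem hb), smul_smul,
        star_fermiSign, fermiSign_mul_self, one_smul, star_star, star_star]
  star_mul x y := by
    induction x using induction_on with
    | add x x' hx hx' => rw [add_mul, star_add', star_add', hx, hx', mul_add]
    | tmul i j a b ha hb =>
      induction y using induction_on with
      | add y y' hy hy' => rw [mul_add, star_add', star_add', hy, hy', add_mul]
      | tmul k l a' b' ha' hb' =>
        rw [tmul_mul_tmul a hb ha' b', star_smul',
          star_tmul (α.mul_mem_part ha ha') (β.mul_mem_part hb hb'), star_tmul ha hb,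
          star_tmul ha' hb', smul_mul_smul_comm,
          tmul_mul_tmul _ (β.star_mem hb') (α.star_mem ha), smul_smul, smul_smul, star_mul,
          star_mul, star_fermiSign, fermiSign_star_mul, mul_assoc]
  star_add := star_add'

instance : StarModule ℂ (FermiTensor α β) where
  star_smul := star_smul'

variable (α β) in
/-- The linear map given by `a ⊗ b ↦ α(a) ⊗ β(b)`. -/
def gradingMap : FermiTensor α β →ₗ[ℂ] FermiTensor α β :=
  (of α β).toLinearMap ∘ₗ
    TensorProduct.map (α.aut : A →ₗ[ℂ] A) (β.aut : B →ₗ[ℂ] B) ∘ₗ (of α β).symm.toLinearMap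

theorem gradingMap_tmul (a : A) (b : B) :
    gradingMap α β (tmul α β a b) = tmul α β (α.aut a) (β.aut b) := rfl

theorem gradingMap_gradingMap (x : FermiTensor α β) :
    gradingMap α β (gradingMap α β x) = x := by
  induction x using induction_on with
  | add x y hx hy => rw [map_add, map_add, hx, hy]
  | tmul i j a b ha hb => rw [gradingMap_tmul, gradingMap_tmul, α.involutive, β.involutive]

variable (α β) in
/-- The grading of the Fermi tensor product, given by `a ⊗ b ↦ α(a) ⊗ β(b)`. -/
def grading : Z2Grading (FermiTensor α β) where
  aut :=
    { toFun := gradingMap α β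
      invFun := gradingMap α β
      left_inv := gradingMap_gradingMap
      right_inv := gradingMap_gradingMap
      map_add' := map_add _
      map_smul' := map_smul _
      map_mul' := fun x y => by
        induction x using induction_on with
        | add x x' hx hx' => rw [add_mul, map_add, map_add, hx, hx', add_mul]
        | tmul i j a b ha hb =>
          induction y using induction_on with
          | add y y' hy hy' => rw [mul_add, map_add, map_add, hy, hy', mul_add]
          | tmul k l a' b' ha' hb' =>
            rw [tmul_mul_tmul a hb ha' b', map_smul, gradingMap_tmul, gradingMap_tmul,
              gradingMap_tmul, tmul_mul_tmul _ (β.aut_mem hb) (α.aut_mem ha'), map_mul, map_mul]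
      map_star' := fun x => by
        induction x using induction_on with
        | add x x' hx hx' => rw [star_add, map_add, map_add, hx, hx', star_add]
        | tmul i j a b ha hb =>
          rw [star_tmul ha hb, map_smul, gradingMap_tmul, gradingMap_tmul,
            star_tmul (α.aut_mem ha) (β.aut_mem hb), map_star, map_star] }
  involutive := gradingMap_gradingMap

variable (α β) in
/-- A representation of the algebraic Fermi tensor product by bounded operators on a complex
Hilbert space. Up to unitary equivalence, every cyclic representation lives on a Hilbert space in
the universe chosen here. -/
structure Rep where
  /-- The Hilbert space. -/
  H : Type (max u v)
  [normedAddCommGroup : NormedAddCommGroup H]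
  [innerProductSpace : InnerProductSpace ℂ H]
  [completeSpace : CompleteSpace H]
  /-- The `*`-homomorphism into the bounded operators. -/
  hom : FermiTensor α β →⋆ₙₐ[ℂ] (H →L[ℂ] H)

attribute [instance] Rep.normedAddCommGroup Rep.innerProductSpace Rep.completeSpace

instance : Inhabited (Rep α β) := ⟨{ H := PUnit, hom := 0 }⟩

/-- The maximal seminorm: the supremum of `‖π(c)‖` over all representations `π`. -/
def maxNorm (c : FermiTensor α β) : ℝ := ⨆ π : Rep α β, ‖π.hom c‖

theorem tmul_one_mul_one_tmul (a : A) (b : B) :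
    tmul α β a 1 * tmul α β 1 b = tmul α β a b := by
  rw [tmul_mul_tmul (i := 0) (j := 0) a (β.mem_part_zero.2 (map_one _))
    (α.mem_part_zero.2 (map_one _))]
  simp [fermiSign]

theorem tmul_one_mul_tmul_one (a a' : A) :
    tmul α β a 1 * tmul α β a' 1 = tmul α β (a * a') 1 := by
  rw [← α.proj_add_proj a', mul_add, add_tmul, add_tmul, mul_add,
    tmul_mul_tmul (j := 0) a (β.mem_part_zero.2 (map_one _)) (α.proj_mem 0 a'),
    tmul_mul_tmul (j := 0) a (β.mem_part_zero.2 (map_one _)) (α.proj_mem 1 a')]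
  simp [fermiSign]

theorem one_tmul_mul_one_tmul (b b' : B) :
    tmul α β 1 b * tmul α β 1 b' = tmul α β 1 (b * b') := by
  rw [← β.proj_add_proj b, add_mul, tmul_add, tmul_add, add_mul,
    tmul_mul_tmul (i := 0) 1 (β.proj_mem 0 b) (α.mem_part_zero.2 (map_one _)),
    tmul_mul_tmul (i := 0) 1 (β.proj_mem 1 b) (α.mem_part_zero.2 (map_one _))]
  simp [fermiSign]

theorem star_tmul_one (a : A) : star (tmul α β a 1) = tmul α β (star a) 1 := by
  rw [← α.proj_add_proj a, star_add, add_tmul, add_tmul, star_add,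
    star_tmul (j := 0) (α.proj_mem 0 a) (β.mem_part_zero.2 (map_one _)),
    star_tmul (j := 0) (α.proj_mem 1 a) (β.mem_part_zero.2 (map_one _))]
  simp [fermiSign]

theorem star_one_tmul (b : B) : star (tmul α β 1 b) = tmul α β 1 (star b) := by
  rw [← β.proj_add_proj b, star_add, tmul_add, tmul_add, star_add,
    star_tmul (i := 0) (α.mem_part_zero.2 (map_one _)) (β.proj_mem 0 b),
    star_tmul (i := 0) (α.mem_part_zero.2 (map_one _)) (β.proj_mem 1 b)]
  simp [fermiSign]

variable (α β) in
/-- The embedding `a ↦ a ⊗ 1`. -/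
def inl : A →⋆ₙₐ[ℂ] FermiTensor α β where
  toFun a := tmul α β a 1
  map_smul' c a := smul_tmul c a 1
  map_zero' := by simp [tmul]
  map_add' a a' := add_tmul a a' 1
  map_mul' a a' := (tmul_one_mul_tmul_one a a').symm
  map_star' a := (star_tmul_one a).symm

variable (α β) in
/-- The embedding `b ↦ 1 ⊗ b`. -/
def inr : B →⋆ₙₐ[ℂ] FermiTensor α β where
  toFun b := tmul α β 1 b
  map_smul' c b := tmul_smul c 1 b
  map_zero' := by simp [tmul]
  map_add' b b' := tmul_add 1 b b'
  map_mul' b b' := (one_tmul_mul_one_tmul b b').symm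
  map_star' b := (star_one_tmul b).symm

theorem norm_hom_tmul_le (π : Rep α β) (a : A) (b : B) :
    ‖π.hom (tmul α β a b)‖ ≤ ‖a‖ * ‖b‖ := by
  rw [← tmul_one_mul_one_tmul, map_mul]
  refine (norm_mul_le _ _).trans ?_
  gcongr
  · exact NonUnitalStarAlgHom.norm_apply_le (π.hom.comp (inl α β)) a
  · exact NonUnitalStarAlgHom.norm_apply_le (π.hom.comp (inr α β)) b

theorem bddAbove_norm_hom (c : FermiTensor α β) :
    BddAbove (Set.range fun π : Rep α β => ‖π.hom c‖) := by
  suffices ∃ C, ∀ π : Rep α β, ‖π.hom c‖ ≤ C by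
    obtain ⟨C, hC⟩ := this
    exact ⟨C, by rintro _ ⟨π, rfl⟩; exact hC π⟩
  induction c using induction_on with
  | tmul i j a b _ _ => exact ⟨‖a‖ * ‖b‖, fun π => norm_hom_tmul_le π a b⟩
  | add x y hx hy =>
    obtain ⟨C, hC⟩ := hx
    obtain ⟨D, hD⟩ := hy
    refine ⟨C + D, fun π => ?_⟩
    rw [map_add]
    exact (norm_add_le _ _).trans (add_le_add (hC π) (hD π))

theorem norm_hom_le_maxNorm (π : Rep α β) (c : FermiTensor α β) : ‖π.hom c‖ ≤ maxNorm c :=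
  le_ciSup (bddAbove_norm_hom c) π

theorem maxNorm_nonneg (c : FermiTensor α β) : 0 ≤ maxNorm c :=
  Real.iSup_nonneg fun _ => norm_nonneg _

theorem maxNorm_smul (z : ℂ) (c : FermiTensor α β) : maxNorm (z • c) = ‖z‖ * maxNorm c := by
  simp only [maxNorm, map_smul, norm_smul]
  exact (Real.mul_iSup_of_nonneg (norm_nonneg z) _).symm

theorem maxNorm_mul_le (c d : FermiTensor α β) : maxNorm (c * d) ≤ maxNorm c * maxNorm d :=
  ciSup_le fun π => by
    rw [map_mul]
    exact (norm_mul_le _ _).trans (mul_le_mul (norm_hom_le_maxNorm π c) (norm_hom_le_maxNorm π d)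
      (norm_nonneg _) (maxNorm_nonneg c))

theorem maxNorm_star (c : FermiTensor α β) : maxNorm (star c) = maxNorm c := by
  simp only [maxNorm, map_star, norm_star]

theorem maxNorm_mul_self_le (c : FermiTensor α β) :
    maxNorm c * maxNorm c ≤ maxNorm (star c * c) := by
  have h : maxNorm c ≤ Real.sqrt (maxNorm (star c * c)) := ciSup_le fun π => by
    refine Real.le_sqrt_of_sq_le ?_
    rw [sq, ← CStarRing.norm_star_mul_self, ← map_star, ← map_mul]
    exact norm_hom_le_maxNorm π _
  calc maxNorm c * maxNorm c ≤ Real.sqrt (maxNorm (star c * c)) * Real.sqrt (maxNorm (star c * c)) :=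
        mul_le_mul h h (maxNorm_nonneg c) (Real.sqrt_nonneg _)
    _ = _ := Real.mul_self_sqrt (maxNorm_nonneg _)

theorem maxNorm_gradingMap_le (c : FermiTensor α β) : maxNorm (gradingMap α β c) ≤ maxNorm c :=
  ciSup_le fun π => norm_hom_le_maxNorm
    { H := π.H, hom := π.hom.comp ((grading α β).aut : FermiTensor α β →⋆ₙₐ[ℂ] FermiTensor α β) } c

theorem maxNorm_gradingMap (c : FermiTensor α β) : maxNorm (gradingMap α β c) = maxNorm c :=
  le_antisymm (maxNorm_gradingMap_le c) (by
    simpa only [gradingMap_gradingMap] using maxNorm_gradingMap_le (gradingMap α β c))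

variable (α β) in
/-- The maximal seminorm as a seminorm of additive groups. -/
def maxSeminorm : AddGroupSeminorm (FermiTensor α β) where
  toFun := maxNorm
  map_zero' := by simpa using maxNorm_smul (0 : ℂ) (0 : FermiTensor α β)
  add_le' c d := ciSup_le fun π => by
    rw [map_add]
    exact (norm_add_le _ _).trans
      (add_le_add (norm_hom_le_maxNorm π c) (norm_hom_le_maxNorm π d))
  neg' c := by simp only [maxNorm, map_neg, norm_neg]

instance : SeminormedRing (FermiTensor α β) where
  toRing := inferInstance
  toNorm := (maxSeminorm α β).toSeminormedAddCommGroup.toNorm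
  toPseudoMetricSpace := (maxSeminorm α β).toSeminormedAddCommGroup.toPseudoMetricSpace
  dist_eq := (maxSeminorm α β).toSeminormedAddCommGroup.dist_eq
  norm_mul_le := maxNorm_mul_le

theorem norm_def (c : FermiTensor α β) : ‖c‖ = maxNorm c := rfl

instance : NormedAlgebra ℂ (FermiTensor α β) where
  norm_smul_le z c := (maxNorm_smul z c).le

instance : NormedStarGroup (FermiTensor α β) where
  norm_star_le c := (maxNorm_star c).le

end FermiTensor

/-- The Fermi `C*`-tensor product: the completion of the algebraic Fermi tensor product with
respect to the maximal norm. -/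
abbrev FermiMax {A B : Type*} [CStarAlgebra A] [CStarAlgebra B]
    (α : Z2Grading A) (β : Z2Grading B) : Type _ := UniformSpace.Completion (FermiTensor α β)

namespace FermiMax

universe u v

variable {A : Type u} {B : Type v} [CStarAlgebra A] [CStarAlgebra B]
variable {α : Z2Grading A} {β : Z2Grading B}

open UniformSpace

instance : Star (FermiMax α β) where
  star := Completion.map star

theorem star_coe (x : FermiTensor α β) :
    star (x : FermiMax α β) = ((star x : FermiTensor α β) : FermiMax α β) :=
  Completion.map_coe (starNormedAddGroupHom (E := FermiTensor α β)).uniformContinuous x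

theorem continuous_star' : Continuous (star : FermiMax α β → FermiMax α β) :=
  Completion.continuous_map

instance : StarRing (FermiMax α β) where
  star_involutive x := by
    induction x using Completion.induction_on with
    | hp => exact isClosed_eq (continuous_star'.comp continuous_star') continuous_id
    | ih x => rw [star_coe, star_coe, star_star]
  star_mul x y := by
    induction x, y using Completion.induction_on₂ with
    | hp =>
      exact isClosed_eq (continuous_star'.comp (continuous_fst.mul continuous_snd))
        ((continuous_star'.comp continuous_snd).mul (continuous_star'.comp continuous_fst))
    | ih x y => rw [← Completion.coe_mul, star_coe, star_coe, star_coe, star_mul, Completion.coe_mul]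
  star_add x y := by
    induction x, y using Completion.induction_on₂ with
    | hp =>
      exact isClosed_eq (continuous_star'.comp (continuous_fst.add continuous_snd))
        ((continuous_star'.comp continuous_fst).add (continuous_star'.comp continuous_snd))
    | ih x y => rw [← Completion.coe_add, star_coe, star_coe, star_coe, star_add, Completion.coe_add]

instance : CStarRing (FermiMax α β) where
  norm_mul_self_le x := by
    induction x using Completion.induction_on with
    | hp =>
      exact isClosed_le (continuous_norm.mul continuous_norm)
        (continuous_norm.comp (continuous_star'.mul continuous_id))
    | ih x =>
      rw [star_coe, ← Completion.coe_mul, Completion.norm_coe, Completion.norm_coe]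
      exact FermiTensor.maxNorm_mul_self_le x

instance : NormedAlgebra ℂ (FermiMax α β) where
  norm_smul_le := norm_smul_le

instance : StarModule ℂ (FermiMax α β) where
  star_smul c x := by
    induction x using Completion.induction_on with
    | hp =>
      exact isClosed_eq (continuous_star'.comp (continuous_const_smul c))
        (continuous_star'.const_smul (star c))
    | ih x => rw [← Completion.coe_smul, star_coe, star_coe, star_smul, Completion.coe_smul]

instance : CStarAlgebra (FermiMax α β) where

variable (α β) in
/-- The elementary tensor `a ⊗ b`, as an element of the Fermi `C*`-tensor product. -/
def tmul (a : A) (b : B) : FermiMax α β := (FermiTensor.tmul α β a b : FermiMax α β)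

theorem uniformContinuous_gradingMap : UniformContinuous (FermiTensor.gradingMap α β) :=
  (AddMonoidHomClass.isometry_of_norm _ FermiTensor.maxNorm_gradingMap).uniformContinuous

variable (α β) in
/-- The continuous extension of `a ⊗ b ↦ α(a) ⊗ β(b)`. -/
def gradingMap : FermiMax α β → FermiMax α β := Completion.map (FermiTensor.gradingMap α β)

theorem gradingMap_coe (x : FermiTensor α β) :
    gradingMap α β (x : FermiMax α β) = (FermiTensor.gradingMap α β x : FermiMax α β) :=
  Completion.map_coe uniformContinuous_gradingMap x

theorem continuous_gradingMap : Continuous (gradingMap α β) := Completion.continuous_map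

theorem gradingMap_gradingMap (x : FermiMax α β) : gradingMap α β (gradingMap α β x) = x := by
  induction x using Completion.induction_on with
  | hp => exact isClosed_eq (continuous_gradingMap.comp continuous_gradingMap) continuous_id
  | ih x => rw [gradingMap_coe, gradingMap_coe, FermiTensor.gradingMap_gradingMap]

variable (α β) in
/-- The grading of the Fermi `C*`-tensor product, extending `a ⊗ b ↦ α(a) ⊗ β(b)`. -/
def grading : Z2Grading (FermiMax α β) where
  aut :=
    { toFun := gradingMap α β
      invFun := gradingMap α β
      left_inv := gradingMap_gradingMap
      right_inv := gradingMap_gradingMap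
      map_add' := fun x y => by
        induction x, y using Completion.induction_on₂ with
        | hp =>
          exact isClosed_eq (continuous_gradingMap.comp (continuous_fst.add continuous_snd))
            ((continuous_gradingMap.comp continuous_fst).add
              (continuous_gradingMap.comp continuous_snd))
        | ih x y =>
          rw [← Completion.coe_add, gradingMap_coe, gradingMap_coe, gradingMap_coe, map_add,
            Completion.coe_add]
      map_mul' := fun x y => by
        induction x, y using Completion.induction_on₂ with
        | hp =>
          exact isClosed_eq (continuous_gradingMap.comp (continuous_fst.mul continuous_snd))
            ((continuous_gradingMap.comp continuous_fst).mul
              (continuous_gradingMap.comp continuous_snd))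
        | ih x y =>
          rw [← Completion.coe_mul, gradingMap_coe, gradingMap_coe, gradingMap_coe,
            ← Completion.coe_mul]
          exact congrArg _ (map_mul (FermiTensor.grading α β).aut x y)
      map_smul' := fun c x => by
        induction x using Completion.induction_on with
        | hp =>
          exact isClosed_eq (continuous_gradingMap.comp (continuous_const_smul c))
            (continuous_gradingMap.const_smul c)
        | ih x =>
          rw [← Completion.coe_smul, gradingMap_coe, gradingMap_coe, map_smul, Completion.coe_smul]
      map_star' := fun x => by
        induction x using Completion.induction_on with
        | hp =>
          exact isClosed_eq (continuous_gradingMap.comp continuous_star')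
            (continuous_star'.comp continuous_gradingMap)
        | ih x =>
          rw [star_coe, gradingMap_coe, gradingMap_coe, star_coe]
          exact congrArg _ (map_star (FermiTensor.grading α β).aut x) }
  involutive := gradingMap_gradingMap

end FermiMax

end

/-! The graded commutation relation is exactly what makes `a₁ ⊗ a₂ ↦ π₁ a₁ * π₂ a₂` a unital
`*`-homomorphism on the algebraic Fermi tensor product (`FermiTensor.lift`). To extend it to the
completion one needs `‖φ c‖ ≤ ‖c‖` for every `*`-homomorphism `φ` into a `C*`-algebra
(`FermiTensor.norm_starAlgHom_le`).

Representing `B` faithfully on a Hilbert space would give this at once, but that space could lie in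
the wrong universe: `Rep` only admits Hilbert spaces in the universe of the two factors, and `B` is
unrelated to it. So the GNS construction is carried out on the source. A state `f` of `B` with `f
(φ(c)* φ(c)) = ‖φ c‖²` exists by `CStarAlgebra.exists_state_apply_eq_norm`. The GNS space of `f ∘ φ`
is a completion of the algebraic tensor product itself, hence admissible, and its unit cyclic vector
`1` shows that `c` acts with norm at least `‖φ c‖`.

Uniqueness and compatibility with gradings follow by density of the span of elementary tensors,
since `*`-homomorphisms of `C*`-algebras are continuous. The range is the generated `C*`-subalgebra
because it contains the generators and is closed (`StarAlgHom.isClosed_range`). -/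

open scoped ComplexOrder InnerProductSpace

/-! ### States attaining the norm of a positive element. -/

section State

variable {B : Type*} [CStarAlgebra B]

/-- A functional of norm at most one that preserves the unit is real on self-adjoint elements. -/
theorem IsSelfAdjoint.im_apply_eq_zero_of_norm_le_one {g : B →L[ℂ] ℂ} (hg : ‖g‖ ≤ 1)
    (hone : g 1 = 1) {a : B} (ha : IsSelfAdjoint a) : (g a).im = 0 := by
  -- Compare `|g (a + it)|² = (re g a)² + (im g a + t)²` with `‖a + it‖² ≤ ‖a‖² + t²`: the terms
  -- `t²` cancel, leaving a bound linear in `t`.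
  have key : ∀ t : ℝ, (g a).im ^ 2 + 2 * (g a).im * t ≤ ‖a‖ ^ 2 := by
    intro t
    have h1 : ‖g (a + (t * Complex.I) • (1 : B))‖ ≤ ‖a + (t * Complex.I) • (1 : B)‖ := by
      simpa using g.le_of_opNorm_le hg (a + (t * Complex.I) • (1 : B))
    have h2 : ‖a + (t * Complex.I) • (1 : B)‖ ^ 2 ≤ ‖a‖ ^ 2 + t ^ 2 := by
      rw [sq, ← CStarRing.norm_star_mul_self]
      have : star (a + (t * Complex.I) • (1 : B)) * (a + (t * Complex.I) • (1 : B)) =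
          star a * a + ((t ^ 2 : ℝ) : ℂ) • (1 : B) := by
        rw [star_add, ha.star_eq, star_smul, star_one]
        simp only [add_mul, mul_add, smul_mul_assoc, mul_smul_comm, one_mul, mul_one, smul_smul,
          smul_add]
        rw [add_assoc, ← add_assoc (star (t * Complex.I : ℂ) • a), ← add_smul, add_comm (star _),
          mul_comm (t * Complex.I : ℂ) (star _)]
        have e1 : (t * Complex.I : ℂ) + star (t * Complex.I : ℂ) = 0 := by simp
        have e2 : star (t * Complex.I : ℂ) * (t * Complex.I) = ((t ^ 2 : ℝ) : ℂ) := by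
          simp only [star_mul', RCLike.star_def, Complex.conj_ofReal, Complex.conj_I]
          push_cast
          linear_combination (-(t : ℂ) ^ 2) * Complex.I_sq
        rw [e1, e2, zero_smul, zero_add]
      rw [this]
      refine (norm_add_le _ _).trans ?_
      rw [CStarRing.norm_star_mul_self, ← sq]
      gcongr
      rw [norm_smul, Complex.norm_real, Real.norm_of_nonneg (sq_nonneg t)]
      rcases subsingleton_or_nontrivial B with h | h
      · rw [Subsingleton.elim (1 : B) 0]
        simp [sq_nonneg]
      · simp
    have h3 : ‖g (a + (t * Complex.I) • (1 : B))‖ ^ 2 = (g a).re ^ 2 + ((g a).im + t) ^ 2 := by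
      rw [← Complex.normSq_eq_norm_sq, Complex.normSq_apply]
      simp [hone]
      ring
    have h4 : ‖g (a + (t * Complex.I) • (1 : B))‖ ^ 2 ≤ ‖a + (t * Complex.I) • (1 : B)‖ ^ 2 := by
      gcongr
    nlinarith [sq_nonneg (g a).re]
  by_contra h
  -- This `t` makes the linear term equal to `‖a‖² + 1`, which exceeds the bound.
  have := key ((‖a‖ ^ 2 + 1) / (2 * (g a).im))
  rw [mul_div_cancel₀ _ (mul_ne_zero two_ne_zero h)] at this
  nlinarith [sq_nonneg (g a).im]

variable [PartialOrder B] [StarOrderedRing B]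

/-- For `a ≥ 0` the element `‖a‖ - a` has norm at most `‖a‖`, so `g a` lies in the disc of radius
`‖a‖` about `‖a‖`; being real, it is nonnegative. -/
theorem ContinuousLinearMap.apply_nonneg_of_norm_le_one {g : B →L[ℂ] ℂ} (hg : ‖g‖ ≤ 1)
    (hone : g 1 = 1) {a : B} (ha : 0 ≤ a) : 0 ≤ g a := by
  have him := (IsSelfAdjoint.of_nonneg ha).im_apply_eq_zero_of_norm_le_one hg hone
  rw [Complex.nonneg_iff]
  refine ⟨?_, him.symm⟩
  have h1 : ‖algebraMap ℝ B ‖a‖ - a‖ ≤ ‖a‖ := by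
    have h0 : 0 ≤ algebraMap ℝ B ‖a‖ - a :=
      sub_nonneg.2 (IsSelfAdjoint.of_nonneg ha).le_algebraMap_norm_self
    rw [CStarAlgebra.norm_le_iff_le_algebraMap _ (norm_nonneg a) h0]
    exact sub_le_self _ ha
  have h2 := (g.le_of_opNorm_le hg (algebraMap ℝ B ‖a‖ - a)).trans ((one_mul _).le.trans h1)
  have h3 : g (algebraMap ℝ B ‖a‖ - a) = ‖a‖ - g a := by
    rw [map_sub, Algebra.algebraMap_eq_smul_one, ← Complex.coe_smul, map_smul, hone]
    simp
  rw [h3] at h2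
  have h4 := (Complex.re_le_norm _).trans h2
  simp at h4
  exact h4

/-- The norm of a positive element is attained by a state. -/
theorem CStarAlgebra.exists_state_apply_eq_norm [Nontrivial B] {b : B} (hb : 0 ≤ b) :
    ∃ f : B →ₚ[ℂ] ℂ, f 1 = 1 ∧ f b = ‖b‖ := by
  have hsa : IsSelfAdjoint b := .of_nonneg hb
  have := hsa.isStarNormal
  have hmem : (‖b‖ : ℂ) ∈ spectrum ℂ b := by
    have := CStarAlgebra.norm_mem_spectrum_of_nonneg (a := b)
    exact spectrum.algebraMap_mem ℂ this
  -- Pass to the commutative `C*`-algebra generated by `b`: the spectrum of `b` is the same there,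
  -- and its points are values of characters.
  let b' : StarAlgebra.elemental ℂ b := ⟨b, StarAlgebra.elemental.self_mem ℂ b⟩
  have hmem' : (‖b‖ : ℂ) ∈ spectrum ℂ b' := by
    have := StarAlgebra.elemental.isClosed ℂ b
    rwa [StarSubalgebra.spectrum_eq (StarAlgebra.elemental ℂ b)]
  obtain ⟨χ, hχ⟩ := WeakDual.CharacterSpace.mem_spectrum_iff_exists.1 hmem'
  let χ' : StarAlgebra.elemental ℂ b →L[ℂ] ℂ :=
    LinearMap.mkContinuous
      { toFun := χ
        map_add' := map_add χ
        map_smul' := map_smul χ } 1 fun x => by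
      rw [one_mul]
      exact spectrum.norm_le_norm_of_mem (AlgHom.apply_mem_spectrum χ x)
  -- Hahn–Banach: the extension keeps norm at most one and the value `1` at the unit, which forces
  -- positivity.
  obtain ⟨g, hg, hgn⟩ := exists_extension_norm_eq
    (Subalgebra.toSubmodule (StarAlgebra.elemental ℂ b).toSubalgebra) χ'
  have hg1 : ‖g‖ ≤ 1 := hgn.trans_le (LinearMap.mkContinuous_norm_le _ zero_le_one _)
  have hgone : g 1 = 1 := (hg ⟨1, one_mem (StarAlgebra.elemental ℂ b)⟩).trans (map_one χ)
  exact ⟨.mk₀ g.toLinearMap fun x hx => g.apply_nonneg_of_norm_le_one hg1 hgone hx, hgone,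
    (hg b').trans hχ⟩

end State

/-! ### Automatic continuity and closed range of `*`-homomorphisms. -/

section ClosedRange

variable {A B : Type*} [CStarAlgebra A] [CStarAlgebra B]

/-- A `*`-homomorphism of `C*`-algebras is continuous. -/
theorem CStarAlgebra.continuous_starHom {F : Type*} [FunLike F A B]
    [NonUnitalAlgHomClass F ℂ A B] [StarHomClass F A B] (φ : F) : Continuous φ :=
  AddMonoidHomClass.continuous_of_bound φ 1 fun x => by
    simpa using NonUnitalStarAlgHom.norm_apply_le φ x

/-- A self-adjoint element of the range of a `*`-homomorphism lifts without increasing its norm. -/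
theorem StarAlgHom.exists_lift_norm_le_of_isSelfAdjoint (π : A →⋆ₐ[ℂ] B) {a : A}
    (ha : IsSelfAdjoint a) : ∃ a', π a' = π a ∧ ‖a'‖ ≤ ‖π a‖ := by
  -- Truncation to `[-‖π a‖, ‖π a‖]`. It is the identity on the spectrum of `π a`, so `cfc f a`
  -- still lifts `π a`, while its values bound the norm of the lift.
  let f : ℝ → ℝ := fun t => max (-‖π a‖) (min t ‖π a‖)
  have hf : Continuous f := by fun_prop
  refine ⟨cfc f a, ?_, ?_⟩
  · rw [StarAlgHomClass.map_cfc π f a hf.continuousOn 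
        (CStarAlgebra.continuous_starHom π)]
    conv_rhs => rw [← cfc_id ℝ (π a) (ha.map π)]
    refine cfc_congr fun x hx => ?_
    have hx' : |x| ≤ ‖π a‖ := by
      rcases subsingleton_or_nontrivial B with h | h
      · rw [spectrum.of_subsingleton] at hx
        exact hx.elim
      · exact spectrum.norm_le_norm_of_mem hx
    obtain ⟨h1, h2⟩ := abs_le.1 hx'
    simp [f, h1, h2]
  · refine norm_cfc_le (norm_nonneg _) fun x _ => ?_
    have := norm_nonneg (π a)
    rw [Real.norm_eq_abs, abs_le]
    exact ⟨le_max_left _ _, max_le (by linarith) (min_le_right _ _)⟩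

/-- Lift the real and imaginary parts separately; the factor `2` is the triangle inequality. Any
constant independent of `a` would serve for closedness of the range. -/
theorem StarAlgHom.exists_lift_norm_le (π : A →⋆ₐ[ℂ] B) (a : A) :
    ∃ a', π a' = π a ∧ ‖a'‖ ≤ 2 * ‖π a‖ := by
  obtain ⟨x, hx, hxn⟩ := π.exists_lift_norm_le_of_isSelfAdjoint (realPart a).2
  obtain ⟨y, hy, hyn⟩ := π.exists_lift_norm_le_of_isSelfAdjoint (imaginaryPart a).2
  refine ⟨x + Complex.I • y, ?_, ?_⟩
  · rw [map_add, map_smul, hx, hy, ← map_smul, ← map_add, realPart_add_I_smul_imaginaryPart]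
  · have h1 : ‖π (realPart a : A)‖ ≤ ‖π a‖ := by
      rw [realPart_apply_coe, ← Complex.coe_smul, map_smul, map_add, map_star, norm_smul]
      have := norm_add_le (π a) (star (π a))
      rw [norm_star] at this
      norm_num
      linarith
    have h2 : ‖π (imaginaryPart a : A)‖ ≤ ‖π a‖ := by
      rw [imaginaryPart_apply_coe, map_smul, ← Complex.coe_smul, map_smul, map_sub, map_star,
        norm_smul, norm_smul]
      have := norm_sub_le (π a) (star (π a))
      rw [norm_star] at this
      norm_num
      linarith
    refine (norm_add_le _ _).trans ?_
    rw [norm_smul, Complex.norm_I]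
    linarith

/-- The range of a `*`-homomorphism of `C*`-algebras is closed. -/
theorem StarAlgHom.isClosed_range (π : A →⋆ₐ[ℂ] B) : IsClosed (Set.range π) := by
  let f : NormedAddGroupHom A B := (π : A →+ B).mkNormedAddGroupHom 1 fun x => by
    rw [one_mul]
    exact NonUnitalStarAlgHom.norm_apply_le π x
  have hf : f.SurjectiveOnWith (π : A →+ B).range 2 := by
    rintro _ ⟨a, rfl⟩
    exact π.exists_lift_norm_le a
  -- Since `A` is complete, a limit of range points is lifted by summing a series of norm-controlled
  -- lifts.
  have h := controlled_closure_of_complete two_pos one_pos hf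
  refine isClosed_of_closure_subset fun b hb => ?_
  obtain ⟨a, ha, -⟩ := h b hb
  exact ⟨a, ha⟩

end ClosedRange

/-! ### The GNS representation of a state pulled back along a `*`-homomorphism. -/

noncomputable section GNS

/-- The space of the representation obtained from a positive functional `f` on `B` by restriction
along `φ : C → B` and the Gelfand-Naimark-Segal construction: a type synonym of `C`, with the
semi-inner product `⟪x, y⟫ = f (φ(x)* φ(y))`. -/
def PullbackPreGNS {B C : Type*} [CStarAlgebra B] [PartialOrder B] [Ring C] [Algebra ℂ C]
    [StarRing C] (_ : B →ₚ[ℂ] ℂ) (_ : C →⋆ₐ[ℂ] B) : Type _ := C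

namespace PullbackPreGNS

open UniformSpace Completion

variable {B C : Type*} [CStarAlgebra B] [PartialOrder B] [StarOrderedRing B] [Ring C]
  [Algebra ℂ C] [StarRing C] (f : B →ₚ[ℂ] ℂ) (φ : C →⋆ₐ[ℂ] B)

instance : AddCommGroup (PullbackPreGNS f φ) := inferInstanceAs (AddCommGroup C)
instance : Module ℂ (PullbackPreGNS f φ) := inferInstanceAs (Module ℂ C)

/-- The identification with the underlying algebra. -/
def of : C ≃ₗ[ℂ] PullbackPreGNS f φ := LinearEquiv.refl ℂ C

/-- The canonical map to the semi-inner product space of `f`. -/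
def toPreGNS : PullbackPreGNS f φ →ₗ[ℂ] f.PreGNS :=
  f.toPreGNS.toLinearMap ∘ₗ (φ : C →ₗ[ℂ] B) ∘ₗ (of f φ).symm.toLinearMap

/-- The semi-inner product induced by `f` and `φ`. -/
abbrev innerCore : PreInnerProductSpace.Core ℂ (PullbackPreGNS f φ) where
  inner x y := ⟪toPreGNS f φ x, toPreGNS f φ y⟫_ℂ
  conj_inner_symm _ _ := inner_conj_symm _ _
  re_inner_nonneg _ := inner_self_nonneg
  add_left _ _ _ := by rw [map_add, inner_add_left]
  smul_left _ _ _ := by rw [map_smul, inner_smul_left]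

instance : SeminormedAddCommGroup (PullbackPreGNS f φ) :=
  InnerProductSpace.Core.toSeminormedAddCommGroup (c := innerCore f φ)

instance : InnerProductSpace ℂ (PullbackPreGNS f φ) := InnerProductSpace.ofCore (innerCore f φ)

theorem norm_def (x : PullbackPreGNS f φ) : ‖x‖ = ‖toPreGNS f φ x‖ := rfl

theorem inner_of (x y : C) : ⟪of f φ x, of f φ y⟫_ℂ = f (star (φ x) * φ y) := rfl

/-- Left multiplication by an element of the algebra. -/
def leftMul (c : C) : PullbackPreGNS f φ →L[ℂ] PullbackPreGNS f φ :=
  ((of f φ).toLinearMap ∘ₗ LinearMap.mulLeft ℂ c ∘ₗ (of f φ).symm.toLinearMap).mkContinuous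
    ‖f.leftMulMapPreGNS (φ c)‖ fun x => by
      rw [norm_def, norm_def]
      -- `toPreGNS` preserves norms and intertwines left multiplication by `c` and by `φ c`, so the
      -- bound known for `φ c` carries over.
      have h : toPreGNS f φ (of f φ (c * (of f φ).symm x)) =
          f.leftMulMapPreGNS (φ c) (toPreGNS f φ x) :=
        congrArg f.toPreGNS (map_mul φ _ _)
      exact (congrArg norm h).trans_le ((f.leftMulMapPreGNS (φ c)).le_opNorm _)

theorem leftMul_of (c x : C) : leftMul f φ c (of f φ x) = of f φ (c * x) := rfl

theorem leftMul_zero : leftMul f φ 0 = 0 :=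
  ContinuousLinearMap.ext fun x => zero_mul ((of f φ).symm x)

theorem leftMul_add (c d : C) : leftMul f φ (c + d) = leftMul f φ c + leftMul f φ d :=
  ContinuousLinearMap.ext fun x => add_mul c d ((of f φ).symm x)

theorem leftMul_smul (m : ℂ) (c : C) : leftMul f φ (m • c) = m • leftMul f φ c :=
  ContinuousLinearMap.ext fun x => smul_mul_assoc m c ((of f φ).symm x)

theorem leftMul_mul (c d : C) : leftMul f φ (c * d) = leftMul f φ c ∘L leftMul f φ d :=
  ContinuousLinearMap.ext fun x => mul_assoc c d ((of f φ).symm x)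

/-- Both sides are `f (φ(x)* φ(c) φ(y))`. By density this makes `rep` preserve `star`. -/
theorem inner_leftMul_star (c : C) (x y : PullbackPreGNS f φ) :
    ⟪leftMul f φ (star c) x, y⟫_ℂ = ⟪x, leftMul f φ c y⟫_ℂ := by
  obtain ⟨x, rfl⟩ := (of f φ).surjective x
  obtain ⟨y, rfl⟩ := (of f φ).surjective y
  rw [leftMul_of, leftMul_of, inner_of, inner_of, map_mul φ, map_mul φ, map_star φ, star_mul, star_star,
    mul_assoc]

theorem _root_.ContinuousLinearMap.completion_smul {E : Type*} [SeminormedAddCommGroup E] [NormedSpace ℂ E] (m : ℂ)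
    (T : E →L[ℂ] E) : (m • T).completion = m • T.completion := by
  ext x
  induction x using Completion.induction_on with
  | hp => exact isClosed_eq (m • T).completion.continuous (m • T.completion).continuous
  | ih x => simp

/-- The representation of `C` by left multiplication on the completion. -/
def rep : C →⋆ₙₐ[ℂ] (Completion (PullbackPreGNS f φ) →L[ℂ] Completion (PullbackPreGNS f φ)) where
  toFun c := (leftMul f φ c).completion
  map_smul' m c := by
    rw [leftMul_smul]
    exact ContinuousLinearMap.completion_smul m _
  map_zero' := by
    ext x
    induction x using Completion.induction_on with
    | hp => apply isClosed_eq <;> fun_prop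
    | ih x => simp [leftMul_zero, Completion.coe_zero]
  map_add' c d := by
    ext x
    induction x using Completion.induction_on with
    | hp => apply isClosed_eq <;> fun_prop
    | ih x => simp [leftMul_add, Completion.coe_add]
  map_mul' c d := by
    ext x
    induction x using Completion.induction_on with
    | hp => apply isClosed_eq <;> fun_prop
    | ih x => simp [leftMul_mul]
  map_star' c := by
    refine (ContinuousLinearMap.eq_adjoint_iff _ _).mpr fun x y => ?_
    induction x, y using Completion.induction_on₂ with
    | hp => apply isClosed_eq <;> fun_prop
    | ih x y => simp [inner_leftMul_star]

/-- The class of `1` is a unit vector because `f 1 = 1`, and `c` moves it to the class of `c`, whose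
squared norm is the left-hand side. -/
theorem re_apply_star_mul_self_le (hf : f 1 = 1) (c : C) :
    (f (star (φ c) * φ c)).re ≤ ‖rep f φ c‖ ^ 2 := by
  have hsq : ∀ x : C, ‖of f φ x‖ ^ 2 = (f (star (φ x) * φ x)).re := fun x => by
    rw [← inner_self_eq_norm_sq (𝕜 := ℂ), inner_of]
    rfl
  have h := (rep f φ c).le_opNorm (of f φ 1 : Completion (PullbackPreGNS f φ))
  have h1 : ‖of f φ 1‖ = 1 := by
    rw [← sq_eq_sq₀ (norm_nonneg _) zero_le_one, hsq]
    simp [hf]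
  have h2 : rep f φ c (of f φ 1 : Completion (PullbackPreGNS f φ)) = (of f φ c : _) := by
    change (leftMul f φ c).completion _ = _
    simp [leftMul_of]
  rw [h2, Completion.norm_coe, Completion.norm_coe, h1, mul_one] at h
  rw [← hsq]
  gcongr

end PullbackPreGNS

end GNS

/-! ### Contractivity for the maximal norm and the algebraic universal property. -/

noncomputable section FermiLift

universe u v w

variable {A₁ : Type u} {A₂ : Type v} {B : Type w} [CStarAlgebra A₁] [CStarAlgebra A₂]
  [CStarAlgebra B] {α₁ : Z2Grading A₁} {α₂ : Z2Grading A₂}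

open UniformSpace

namespace FermiTensor

/-- Every `*`-homomorphism into a `C*`-algebra is contractive for the maximal norm. -/
theorem norm_starAlgHom_le (φ : FermiTensor α₁ α₂ →⋆ₐ[ℂ] B) (c : FermiTensor α₁ α₂) :
    ‖φ c‖ ≤ ‖c‖ := by
  -- The zero algebra has no state and is treated apart.
  rcases subsingleton_or_nontrivial B with h | h
  · rw [Subsingleton.elim (φ c) 0, norm_zero]
    exact norm_nonneg c
  let := CStarAlgebra.spectralOrder B
  let := CStarAlgebra.spectralOrderedRing B
  obtain ⟨f, hf1, hf⟩ := CStarAlgebra.exists_state_apply_eq_norm (star_mul_self_nonneg (φ c))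
  have h := PullbackPreGNS.re_apply_star_mul_self_le f φ hf1 c
  rw [hf, Complex.ofReal_re, CStarRing.norm_star_mul_self, ← sq] at h
  -- Admissible whatever the universe of `B`: the Hilbert space is a completion of `FermiTensor α₁
  -- α₂`.
  let ρ : Rep α₁ α₂ := { H := Completion (PullbackPreGNS f φ), hom := PullbackPreGNS.rep f φ }
  exact (le_of_sq_le_sq h (norm_nonneg _)).trans (norm_hom_le_maxNorm ρ c)

theorem continuous_starAlgHom (φ : FermiTensor α₁ α₂ →⋆ₐ[ℂ] B) :
    Continuous (φ : FermiTensor α₁ α₂ →+* B) :=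
  AddMonoidHomClass.continuous_of_bound φ 1 fun c => by
    simpa using norm_starAlgHom_le φ c

variable (π₁ : A₁ →⋆ₐ[ℂ] B) (π₂ : A₂ →⋆ₐ[ℂ] B)

variable (α₁ α₂) in
/-- The linear map `a₁ ⊗ a₂ ↦ π₁(a₁) π₂(a₂)`. -/
def liftLinear : FermiTensor α₁ α₂ →ₗ[ℂ] B :=
  LinearMap.mul' ℂ B ∘ₗ TensorProduct.map (π₁ : A₁ →ₗ[ℂ] B) (π₂ : A₂ →ₗ[ℂ] B) ∘ₗ
    (of α₁ α₂).symm.toLinearMap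

theorem liftLinear_tmul (a₁ : A₁) (a₂ : A₂) :
    liftLinear α₁ α₂ π₁ π₂ (tmul α₁ α₂ a₁ a₂) = π₁ a₁ * π₂ a₂ := rfl

variable {π₁ π₂} (hcomm : ∀ (i j : ZMod 2) (a₁ : A₁) (a₂ : A₂), a₁ ∈ α₁.part i →
  a₂ ∈ α₂.part j → π₁ a₁ * π₂ a₂ = fermiSign i j • (π₂ a₂ * π₁ a₁))

/-- The universal property of the algebraic Fermi tensor product. -/
def lift : FermiTensor α₁ α₂ →⋆ₐ[ℂ] B where
  __ := AlgHom.ofLinearMap (liftLinear α₁ α₂ π₁ π₂)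
    (by rw [one_def, liftLinear_tmul, map_one, map_one, mul_one])
    (fun x y => by
      induction x using induction_on with
      | add x x' hx hx' => rw [add_mul, map_add, map_add, hx, hx', add_mul]
      | tmul i j a b ha hb =>
        induction y using induction_on with
        | add y y' hy hy' => rw [mul_add, map_add, map_add, hy, hy', mul_add]
        | tmul k l a' b' ha' hb' =>
          -- Exchanging the inner factors `π₁ a'` and `π₂ b` produces a second copy of the sign in
          -- the product, and the two cancel.
          rw [tmul_mul_tmul a hb ha' b', map_smul, liftLinear_tmul, liftLinear_tmul,
            liftLinear_tmul, map_mul, map_mul, mul_assoc (π₁ a), ← mul_assoc (π₁ a'),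
            hcomm k j a' b ha' hb, mul_assoc (π₁ a), ← mul_assoc (π₂ b), smul_mul_assoc,
            mul_smul_comm, smul_smul]
          rw [show fermiSign j k = fermiSign k j by simp only [fermiSign, and_comm],
            fermiSign_mul_self, one_smul, mul_assoc])
  map_star' x := by
    change liftLinear α₁ α₂ π₁ π₂ (star x) = star (liftLinear α₁ α₂ π₁ π₂ x)
    induction x using induction_on with
    | add x y hx hy => rw [star_add, map_add, map_add, hx, hy, star_add]
    | tmul i j a b ha hb =>
      -- The sign in the involution cancels the one from restoring the order reversed by `star`.
      rw [star_tmul ha hb, map_smul, liftLinear_tmul, liftLinear_tmul,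
        hcomm i j _ _ (α₁.star_mem ha) (α₂.star_mem hb), smul_smul, fermiSign_mul_self, one_smul,
        star_mul, map_star, map_star]

end FermiTensor

/-! ### Extension to the completion, density and range. -/

namespace FermiMax

/-- The extension of a `*`-homomorphism from the algebraic Fermi tensor product to its
completion. -/
def extend (φ : FermiTensor α₁ α₂ →⋆ₐ[ℂ] B) : FermiMax α₁ α₂ →⋆ₐ[ℂ] B :=
  have hφ := FermiTensor.continuous_starAlgHom φ
  have hE : Continuous (Completion.extensionHom (φ : FermiTensor α₁ α₂ →+* B) hφ) :=
    Completion.continuous_extension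
  { Completion.extensionHom (φ : FermiTensor α₁ α₂ →+* B) hφ with
    commutes' := fun r => by
      have h : algebraMap ℂ (FermiMax α₁ α₂) r =
          ((algebraMap ℂ (FermiTensor α₁ α₂) r : FermiTensor α₁ α₂) : FermiMax α₁ α₂) := rfl
      rw [h]
      exact (Completion.extensionHom_coe _ hφ _).trans (AlgHomClass.commutes φ r)
    map_star' := fun x => by
      change Completion.extensionHom (φ : FermiTensor α₁ α₂ →+* B) hφ (star x) =
        star (Completion.extensionHom (φ : FermiTensor α₁ α₂ →+* B) hφ x)
      induction x using Completion.induction_on with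
      | hp => exact isClosed_eq (hE.comp continuous_star') (continuous_star.comp hE)
      | ih x =>
        rw [star_coe, Completion.extensionHom_coe, Completion.extensionHom_coe]
        exact map_star φ x }

theorem extend_coe (φ : FermiTensor α₁ α₂ →⋆ₐ[ℂ] B) (c : FermiTensor α₁ α₂) :
    extend φ (c : FermiMax α₁ α₂) = φ c :=
  Completion.extensionHom_coe (φ : FermiTensor α₁ α₂ →+* B) (FermiTensor.continuous_starAlgHom φ) c

/-- Continuous additive maps that agree on elementary tensors are equal. -/
theorem addMonoidHom_ext {φ ψ : FermiMax α₁ α₂ →+ B} (hφ : Continuous φ) (hψ : Continuous ψ)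
    (h : ∀ a₁ a₂, φ (tmul α₁ α₂ a₁ a₂) = ψ (tmul α₁ α₂ a₁ a₂)) : φ = ψ := by
  ext x
  induction x using Completion.induction_on with
  | hp => exact isClosed_eq hφ hψ
  | ih x =>
    induction x using FermiTensor.induction_on with
    | tmul i j a b _ _ => exact h a b
    | add x y hx hy => rw [Completion.coe_add, map_add, map_add, hx, hy]

/-- The range of a `*`-homomorphism that is given by `a₁ ⊗ a₂ ↦ π₁(a₁) π₂(a₂)`. -/
theorem range_eq_topologicalClosure_adjoin {π : FermiMax α₁ α₂ →⋆ₐ[ℂ] B} {π₁ : A₁ →⋆ₐ[ℂ] B}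
    {π₂ : A₂ →⋆ₐ[ℂ] B} (h : ∀ a₁ a₂, π (tmul α₁ α₂ a₁ a₂) = π₁ a₁ * π₂ a₂) :
    π.range = (StarAlgebra.adjoin ℂ (Set.range π₁ ∪ Set.range π₂)).topologicalClosure := by
  apply le_antisymm
  · rintro _ ⟨x, rfl⟩
    change π x ∈ _
    induction x using Completion.induction_on with
    | hp => exact (StarSubalgebra.isClosed_topologicalClosure _).preimage (CStarAlgebra.continuous_starHom π)
    | ih x =>
      induction x using FermiTensor.induction_on with
      | tmul i j a b _ _ =>
        refine StarSubalgebra.le_topologicalClosure _ ?_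
        change π (tmul α₁ α₂ a b) ∈ _
        rw [h]
        exact mul_mem (StarAlgebra.subset_adjoin ℂ _ (.inl ⟨a, rfl⟩))
          (StarAlgebra.subset_adjoin ℂ _ (.inr ⟨b, rfl⟩))
      | add x y hx hy =>
        rw [Completion.coe_add, map_add]
        exact add_mem hx hy
  · refine StarSubalgebra.topologicalClosure_minimal (StarAlgebra.adjoin_le ?_) ?_
    · rintro _ (⟨a, rfl⟩ | ⟨a, rfl⟩)
      · exact ⟨tmul α₁ α₂ a 1, (h a 1).trans (by rw [map_one, mul_one])⟩
      · exact ⟨tmul α₁ α₂ 1 a, (h 1 a).trans (by rw [map_one, one_mul])⟩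
    -- Closedness lets the range contain the closure of the algebra generated by both images.
    · exact π.isClosed_range

end FermiMax

end FermiLift

theorem mainTheorem6 {A₁ A₂ B : Type*} [CStarAlgebra A₁] [CStarAlgebra A₂] [CStarAlgebra B]
    (α₁ : Z2Grading A₁) (α₂ : Z2Grading A₂) (π₁ : A₁ →⋆ₐ[ℂ] B) (π₂ : A₂ →⋆ₐ[ℂ] B)
    (hcomm : ∀ (i j : ZMod 2) (a₁ : A₁) (a₂ : A₂), a₁ ∈ α₁.part i → a₂ ∈ α₂.part j →
      π₁ a₁ * π₂ a₂ = fermiSign i j • (π₂ a₂ * π₁ a₁)) :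
    ∃ π : FermiMax α₁ α₂ →⋆ₐ[ℂ] B,
      (∀ a₁ a₂, π (FermiMax.tmul α₁ α₂ a₁ a₂) = π₁ a₁ * π₂ a₂) ∧
      (∀ ρ : FermiMax α₁ α₂ →⋆ₙₐ[ℂ] B,
        (∀ a₁ a₂, ρ (FermiMax.tmul α₁ α₂ a₁ a₂) = π₁ a₁ * π₂ a₂) → ∀ x, ρ x = π x) ∧
      π.range =
        (StarAlgebra.adjoin ℂ (Set.range π₁ ∪ Set.range π₂)).topologicalClosure ∧
      ∀ β : Z2Grading B,
        (∀ a₁, π₁ (α₁.aut a₁) = β.aut (π₁ a₁)) → (∀ a₂, π₂ (α₂.aut a₂) = β.aut (π₂ a₂)) →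
          ∀ x, π ((FermiMax.grading α₁ α₂).aut x) = β.aut (π x) := by
  have hπ : ∀ a₁ a₂, FermiMax.extend (FermiTensor.lift hcomm) (FermiMax.tmul α₁ α₂ a₁ a₂) =
      π₁ a₁ * π₂ a₂ := fun a₁ a₂ => FermiMax.extend_coe _ _
  have hc := CStarAlgebra.continuous_starHom (FermiMax.extend (FermiTensor.lift hcomm))
  refine ⟨FermiMax.extend (FermiTensor.lift hcomm), hπ, fun ρ hρ x => ?_,
    FermiMax.range_eq_topologicalClosure_adjoin hπ, fun β h₁ h₂ x => ?_⟩
  -- Neither continuity nor unitality of `ρ` has to be assumed: the first is automatic, and the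
  -- density argument uses only additivity.
  · exact DFunLike.congr_fun (FermiMax.addMonoidHom_ext
      (φ := (ρ : FermiMax α₁ α₂ →+ B))
      (ψ := (FermiMax.extend (FermiTensor.lift hcomm) : FermiMax α₁ α₂ →+ B))
      (CStarAlgebra.continuous_starHom ρ) hc fun a₁ a₂ => (hρ a₁ a₂).trans (hπ a₁ a₂).symm) x
  -- Both composites are continuous and send `a₁ ⊗ a₂` to `β(π₁ a₁) β(π₂ a₂)`.
  · refine DFunLike.congr_fun (FermiMax.addMonoidHom_ext
      (φ := (FermiMax.extend (FermiTensor.lift hcomm) : FermiMax α₁ α₂ →+ B).comp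
        ((FermiMax.grading α₁ α₂).aut : FermiMax α₁ α₂ →+ FermiMax α₁ α₂))
      (ψ := (β.aut : B →+ B).comp
        (FermiMax.extend (FermiTensor.lift hcomm) : FermiMax α₁ α₂ →+ B))
      (hc.comp FermiMax.continuous_gradingMap)
      ((CStarAlgebra.continuous_starHom β.aut).comp hc) fun a₁ a₂ => ?_) x
    have hg : (FermiMax.grading α₁ α₂).aut (FermiMax.tmul α₁ α₂ a₁ a₂) =
        FermiMax.tmul α₁ α₂ (α₁.aut a₁) (α₂.aut a₂) := FermiMax.gradingMap_coe _
    change FermiMax.extend (FermiTensor.lift hcomm)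
        ((FermiMax.grading α₁ α₂).aut (FermiMax.tmul α₁ α₂ a₁ a₂)) =
      β.aut (FermiMax.extend (FermiTensor.lift hcomm) (FermiMax.tmul α₁ α₂ a₁ a₂))
    rw [hg, hπ, hπ, h₁, h₂, map_mul]
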